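/- Let $n,p\in\mathbb N=\{1,2,3,\dots\}$ and let $\mathcal U=\{z\in\mathbb C:|z|<1\}$. Let $\mathcal A(n,p)$ be the class of functions $f(z)=z^p+\sum_{k=n+p}^\infty a_kz^k$ that are analytic and $p$-valent in $\mathcal U$ (counted with multiplicity, $f$ takes no value more than $p$ times in $\mathcal U$, and takes some value exactly $p$ times). For real $\lambda\ge\mu\ge0$, $l\ge0$, $\delta\ge0$ and $f\in\mathcal A(n,p)$ put $$\mathcal J_p^\delta(\lambda,\mu,l)f(z)=z^p+\sum_{k=n+p}^\infty\left[\frac{(k-p)(\lambda\mu k+\lambda-\mu)+p+l}{p+l}\right]^{\delta}a_kz^k\qquad(z\in\mathcal U).$$ For functions $F,G$ on $\mathcal U$ write $F\prec G$ if there is an analytic $w:\mathcal U\to\mathcal U$ with $w(0)=0$ and $F(z)=G(w(z))$ for all $z\in\mathcal U$. For real $A,B,\sigma$ with $-1\le A<B\le1$, $0<B\le1$ and $0\le\sigma<p$, let $\mathcal P^{\delta}_{\lambda,\mu,l}(A,B;\sigma,p)$ be the class of all $f\in\mathcal A(n,p)$ such that $$\frac1{p-\sigma}\left(\frac{[\mathcal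 J_p^\delta(\lambda,\mu,l)f(z)]'}{z^{p-1}}-\sigma\right)\prec\frac{1+Az}{1+Bz},$$ where the left-hand side is given its limit value $1$ at the removable singularity $z=0$. **Theorem 2.1.** Let $n,p\in\mathbb N$, and let $\lambda\ge\mu\ge0$, $l\ge0$, $\delta\ge0$, $-1\le A<B\le1$, $0<B\le1$, $0\le\sigma<p$ be real. If $\lambda-\mu\ge\dfrac{l+p}{2p}$ or $\lambda=\mu=0$, then $$\mathcal P^{\delta+1}_{\lambda,\mu,l}(A,B;\sigma,p)\subseteq\mathcal P^{\delta}_{\lambda,\mu,l}(A,B;\sigma,p).$$ -/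

import Mathlib

namespace Multivalent

/-- The open unit disk `U`. -/
abbrev unitDisk : Set ℂ := Metric.ball (0 : ℂ) 1

/-- `f` is `p`-valent in the unit disk: counted with multiplicity, it takes no value more than
`p` times, and it takes some value exactly `p` times. -/
def IsPValent (p : ℕ) (f : ℂ → ℂ) : Prop :=
  (∀ (c : ℂ) (S : Finset ℂ), (S : Set ℂ) ⊆ unitDisk →
      ∑ z ∈ S, analyticOrderAt (fun ζ => f ζ - c) z ≤ (p : ℕ∞)) ∧
    ∃ (c : ℂ) (S : Finset ℂ), (S : Set ℂ) ⊆ unitDisk ∧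
      ∑ z ∈ S, analyticOrderAt (fun ζ => f ζ - c) z = (p : ℕ∞)

/-- The class `A(n,p)`: functions `f(z) = z^p + ∑_{k ≥ n+p} a_k z^k` that are analytic and
`p`-valent in the unit disk (values outside the disk play no role). -/
def classA (n p : ℕ) : Set (ℂ → ℂ) :=
  {f | DifferentiableOn ℂ f unitDisk ∧ IsPValent p f ∧
    ∃ a : ℕ → ℂ, ∀ z ∈ unitDisk,
      HasSum (fun j : ℕ => a (n + p + j) * z ^ (n + p + j)) (f z - z ^ p)}

/-- The `k`-th Taylor coefficient of `f` at the origin. -/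
noncomputable def taylorCoeff (f : ℂ → ℂ) (k : ℕ) : ℂ :=
  iteratedDeriv k f 0 / (Nat.factorial k : ℂ)

/-- The multiplier
`Φ_p^k(δ,λ,μ,l) = [((k-p)(λ μ k + λ - μ) + p + l) / (p + l)]^δ`, with a real exponent `δ`. -/
noncomputable def multiplier (p k : ℕ) (δ lam mu l : ℝ) : ℝ :=
  ((((k : ℝ) - (p : ℝ)) * (lam * mu * (k : ℝ) + lam - mu) + (p : ℝ) + l) / ((p : ℝ) + l)) ^ δ

/-- The multiplier transformation
`J_p^δ(λ,μ,l) f(z) = z^p + ∑_{k ≥ n+p} Φ_p^k(δ,λ,μ,l) a_k z^k` of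
`f(z) = z^p + ∑_{k ≥ n+p} a_k z^k`. -/
noncomputable def multiplierTransform (n p : ℕ) (δ lam mu l : ℝ) (f : ℂ → ℂ) (z : ℂ) : ℂ :=
  z ^ p + ∑' j : ℕ, (multiplier p (n + p + j) δ lam mu l : ℂ) * taylorCoeff f (n + p + j) *
    z ^ (n + p + j)

/-- Subordination `F ≺ G` in the unit disk: `F = G ∘ w` there for a Schwarz function `w`. -/
def Subordinate (F G : ℂ → ℂ) : Prop :=
  ∃ w : ℂ → ℂ, DifferentiableOn ℂ w unitDisk ∧ w 0 = 0 ∧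
    (∀ z ∈ unitDisk, ‖w z‖ < 1) ∧ ∀ z ∈ unitDisk, F z = G (w z)

/-- The normalised derivative `(g'(z) / z^(p-1) - σ) / (p - σ)` of a function
`g(z) = z^p + ∑_{k > p} b_k z^k`. Its singularity at `0` is removable, with value
`(p - σ) / (p - σ) = 1`. -/
noncomputable def normalizedDeriv (p : ℕ) (σ : ℝ) (g : ℂ → ℂ) (z : ℂ) : ℂ :=
  if z = 0 then 1
  else 1 / ((p : ℂ) - (σ : ℂ)) * (deriv g z / z ^ (p - 1) - (σ : ℂ))

/-- The class `P^δ_{λ,μ,l}(A,B;σ,p)` of functions in `A(n,p)`. -/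
def classP (n p : ℕ) (lam mu l δ A B σ : ℝ) : Set (ℂ → ℂ) :=
  {f | f ∈ classA n p ∧
    Subordinate (normalizedDeriv p σ (multiplierTransform n p δ lam mu l f))
      (fun z => (1 + (A : ℂ) * z) / (1 + (B : ℂ) * z))}

end Multivalent

namespace Multivalent

open Metric Complex

/-! Let θ = z d/dz. After division by z^(p-1), the term of index k becomes one of exponent m = k -
p, and the multiplier with exponent one is 1 + a m + c m² with a, c ≥ 0. Hence the normalised
derivatives satisfy F_{δ+1} = (1 + aθ + cθ²) F_δ. Subordination to (1 + Az)/(1 + Bz) means lying in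
its image, a disk or half-plane that is a sublevel set of the convex quadratic `diskGauge`. Where
the gauge of F_δ is maximal on a closed disk, a supporting functional Re(v ·) of the gauge is
maximal too, so Re(vθF_δ) ≥ 0 (radially) and Re(vθ²F_δ) ≥ 0 (along the circle). By convexity the
gauge of F_{δ+1} there is at least that of F_δ, so a bound for F_{δ+1} passes to F_δ
(`diskGauge_lt_of_operator`). -/

/-- The sequence `b` is the coefficient sequence of a power series converging in the unit disk. -/
def DiskSummable (b : ℕ → ℂ) : Prop :=
  ∀ r : ℝ, 0 ≤ r → r < 1 → Summable fun j => ‖b j‖ * r ^ j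

/-- The power series `∑ b_j z^(N+j)`. -/
noncomputable def tailSeries (N : ℕ) (b : ℕ → ℂ) (z : ℂ) : ℂ := ∑' j, b j * z ^ (N + j)

/-! ### Power series in the unit disk -/

theorem DiskSummable.mono {b c : ℕ → ℂ} (hb : DiskSummable b) (h : ∀ j, ‖c j‖ ≤ ‖b j‖) :
    DiskSummable c := fun r h0 h1 =>
  (hb r h0 h1).of_nonneg_of_le (fun j => by positivity)
    (fun j => mul_le_mul_of_nonneg_right (h j) (by positivity))

theorem DiskSummable.add {b c : ℕ → ℂ} (hb : DiskSummable b) (hc : DiskSummable c) :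
    DiskSummable fun j => b j + c j := fun r h0 h1 =>
  ((hb r h0 h1).add (hc r h0 h1)).of_nonneg_of_le (fun j => by positivity) (fun j => by
    rw [← add_mul]
    exact mul_le_mul_of_nonneg_right (norm_add_le _ _) (by positivity))

theorem DiskSummable.const_mul {b : ℕ → ℂ} (hb : DiskSummable b) (c : ℂ) :
    DiskSummable fun j => c * b j := fun r h0 h1 => by
  simpa [mul_assoc] using (hb r h0 h1).mul_left ‖c‖

/-- For r < s < 1 the sequence j (r/s)^j is bounded, so the factor j is absorbed by passing from r
to s. -/
theorem DiskSummable.nat_mul {b : ℕ → ℂ} (hb : DiskSummable b) :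
    DiskSummable fun j => (j : ℂ) * b j := by
  intro r h0 h1
  obtain ⟨s, hrs, hs1⟩ := exists_between h1
  have hs0 : 0 < s := h0.trans_lt hrs
  have hq : |r / s| < 1 := by
    rw [abs_of_nonneg (by positivity), div_lt_one hs0]; exact hrs
  have ht := tendsto_pow_const_mul_const_pow_of_abs_lt_one 1 hq
  obtain ⟨C, hC⟩ := ht.bddAbove_range
  refine ((hb s hs0.le hs1).mul_left C).of_nonneg_of_le (fun j => by positivity) fun j => ?_
  have h := hC ⟨j, rfl⟩
  simp only [pow_one] at h
  have : (j : ℝ) * r ^ j ≤ C * s ^ j := by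
    rw [div_pow, ← mul_div_assoc, div_le_iff₀ (by positivity)] at h
    exact h
  calc ‖(j : ℂ) * b j‖ * r ^ j = ‖b j‖ * (j * r ^ j) := by simp; ring
    _ ≤ ‖b j‖ * (C * s ^ j) := mul_le_mul_of_nonneg_left this (norm_nonneg _)
    _ = C * (‖b j‖ * s ^ j) := by ring

theorem DiskSummable.nat_add_mul {b : ℕ → ℂ} (hb : DiskSummable b) (N : ℕ) :
    DiskSummable fun j => ((N + j : ℕ) : ℂ) * b j := by
  convert (hb.const_mul N).add hb.nat_mul using 2
  push_cast; ring

theorem DiskSummable.summable {b : ℕ → ℂ} (hb : DiskSummable b) (N : ℕ) {z : ℂ}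
    (hz : z ∈ unitDisk) : Summable fun j => b j * z ^ (N + j) := by
  rw [mem_ball_zero_iff] at hz
  refine Summable.of_norm ?_
  refine ((hb ‖z‖ (norm_nonneg _) hz).mul_left (‖z‖ ^ N)).congr fun j => ?_
  rw [norm_mul, norm_pow, pow_add]; ring

theorem hasDerivAt_tailSeries {N : ℕ} (hN : 1 ≤ N) {b : ℕ → ℂ} (hb : DiskSummable b) {z : ℂ}
    (hz : z ∈ unitDisk) :
    HasDerivAt (tailSeries N b)
      (tailSeries (N - 1) (fun j => ((N + j : ℕ) : ℂ) * b j) z) z := by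
  rw [mem_ball_zero_iff] at hz
  obtain ⟨r, hzr, hr1⟩ := exists_between hz
  have hr0 : 0 < r := (norm_nonneg z).trans_lt hzr
  refine hasDerivAt_tsum_of_isPreconnected (t := ball 0 r) (y₀ := z)
    (g := fun j z => b j * z ^ (N + j))
    (g' := fun j z => ((N + j : ℕ) : ℂ) * b j * z ^ (N - 1 + j))
    (hb.nat_add_mul N r hr0.le hr1) isOpen_ball (convex_ball _ _).isPreconnected ?_ ?_
    (by simpa using hzr) (hb.summable N (by simpa using hz)) (by simpa using hzr)
  · intro j y _
    refine ((hasDerivAt_pow (N + j) y).const_mul (b j)).congr_deriv ?_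
    rw [show N + j - 1 = N - 1 + j by omega]; ring
  · intro j y hy
    rw [mem_ball_zero_iff] at hy
    rw [norm_mul, norm_pow]
    refine mul_le_mul_of_nonneg_left ?_ (norm_nonneg _)
    calc ‖y‖ ^ (N - 1 + j) ≤ ‖y‖ ^ j :=
          pow_le_pow_of_le_one (norm_nonneg _) (hy.trans hr1).le (by omega)
      _ ≤ r ^ j := pow_le_pow_left₀ (norm_nonneg _) hy.le _

theorem tailSeries_add_index (N p : ℕ) (b : ℕ → ℂ) (z : ℂ) :
    tailSeries (N + p) b z = z ^ p * tailSeries N b z := by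
  unfold tailSeries
  rw [← tsum_mul_left]
  congr 1; ext j; rw [show N + p + j = p + (N + j) by omega, pow_add z p]; ring

theorem tailSeries_const_mul (N : ℕ) (c : ℂ) (b : ℕ → ℂ) (z : ℂ) :
    tailSeries N (fun j => c * b j) z = c * tailSeries N b z := by
  unfold tailSeries
  rw [← tsum_mul_left]
  simp only [mul_assoc]

theorem tailSeries_zero {N : ℕ} (hN : 1 ≤ N) (b : ℕ → ℂ) : tailSeries N b 0 = 0 := by
  unfold tailSeries
  refine (tsum_congr fun j => ?_).trans tsum_zero
  rw [zero_pow (by omega), mul_zero]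

/-! ### The Euler operator at a maximum -/

/-- The Euler operator `z d/dz` acts on coefficients by multiplication with the exponent. -/
theorem hasDerivAt_tailSeries_comp {N : ℕ} (hN : 1 ≤ N) {b : ℕ → ℂ} (hb : DiskSummable b)
    {γ : ℝ → ℂ} {κ : ℂ} {t : ℝ} (hγ : HasDerivAt γ (κ * γ t) t) (ht : γ t ∈ unitDisk) :
    HasDerivAt (fun s => tailSeries N b (γ s))
      (κ * tailSeries N (fun j => ((N + j : ℕ) : ℂ) * b j) (γ t)) t := by
  refine ((hasDerivAt_tailSeries hN hb ht).comp t hγ).congr_deriv ?_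
  have := tailSeries_add_index (N - 1) 1 (fun j => ((N + j : ℕ) : ℂ) * b j) (γ t)
  rw [Nat.sub_add_cancel hN, pow_one] at this
  rw [this]; ring

theorem hasDerivAt_re_const_mul {g : ℝ → ℂ} {g' : ℂ} {t : ℝ} (h : HasDerivAt g g' t) (v : ℂ) :
    HasDerivAt (fun s => (v * g s).re) (v * g').re t :=
  (reCLM.hasFDerivAt.comp_hasDerivAt t (h.const_mul v))

/-- The second derivative is non-positive at a global maximum. -/
theorem second_deriv_nonpos_of_forall_le {u u' : ℝ → ℝ} {c t : ℝ}
    (hu : ∀ s, HasDerivAt u (u' s) s) (hu' : HasDerivAt u' c t) (hmax : ∀ s, u s ≤ u t) :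
    c ≤ 0 := by
  by_contra! hc
  have hd : deriv u = u' := funext fun s => (hu s).deriv
  have hlm : IsLocalMax u t := Filter.Eventually.of_forall hmax
  have hmin : IsLocalMin u t := isLocalMin_of_deriv_deriv_pos (by rw [hd, hu'.deriv]; exact hc)
    hlm.deriv_eq_zero (hu t).continuousAt
  -- A local maximum that is also a local minimum forces local constancy, hence a zero second
  -- derivative.
  have heq : u =ᶠ[nhds t] fun _ => u t := by
    filter_upwards [hmin] with s hs using le_antisymm (hmax s) hs
  have h2 : deriv (deriv u) t = 0 := by
    rw [heq.deriv.deriv_eq]; simp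
  rw [hd, hu'.deriv] at h2
  exact hc.ne' h2

/-- Along the ray t ↦ e^t z with t ≤ 0 the maximum sits at the endpoint t = 0, so the derivative
there, which is Re(vθg), is non-negative. -/
theorem euler_re_nonneg {N : ℕ} (hN : 1 ≤ N) {b : ℕ → ℂ} (hb : DiskSummable b) {v z : ℂ}
    (hz : z ∈ unitDisk)
    (hmax : ∀ y : ℂ, ‖y‖ ≤ ‖z‖ → (v * tailSeries N b y).re ≤ (v * tailSeries N b z).re) :
    0 ≤ (v * tailSeries N (fun j => ((N + j : ℕ) : ℂ) * b j) z).re := by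
  have hγ : HasDerivAt (fun t : ℝ => Complex.exp t * z) (1 * (Complex.exp (0 : ℝ) * z)) 0 := by
    exact ((Complex.hasDerivAt_exp ((0 : ℝ) : ℂ)).comp_ofReal.mul_const z).congr_deriv
      (one_mul _).symm
  have h := hasDerivAt_re_const_mul
    (hasDerivAt_tailSeries_comp hN hb hγ (by simpa using hz)) v
  simp only [ofReal_zero, Complex.exp_zero, one_mul] at h
  have hm : IsMaxOn (fun t : ℝ => (v * tailSeries N b (Complex.exp t * z)).re) (Set.Iic 0) 0 := by
    intro t ht
    have : ‖Complex.exp t * z‖ ≤ ‖z‖ := by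
      rw [norm_mul, Complex.norm_exp_ofReal]
      exact mul_le_of_le_one_left (norm_nonneg _) (Real.exp_le_one_iff.2 ht)
    simpa using hmax _ this
  have h2 := hm.localize.hasFDerivWithinAt_nonpos h.hasFDerivAt.hasFDerivWithinAt (y := -1)
    (mem_posTangentConeAt_of_segment_subset (by
      rw [zero_add, segment_symm, segment_eq_Icc (by norm_num)]
      exact Set.Icc_subset_Iic_self))
  simpa using h2

/-- On the circle t ↦ e^(it) z, d/dt acts as iθ, so the second derivative is -Re(vθ²g), non-positive
at a maximum. -/
theorem euler_sq_re_nonneg {N : ℕ} (hN : 1 ≤ N) {b : ℕ → ℂ} (hb : DiskSummable b) {v z : ℂ}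
    (hz : z ∈ unitDisk)
    (hmax : ∀ y : ℂ, ‖y‖ ≤ ‖z‖ → (v * tailSeries N b y).re ≤ (v * tailSeries N b z).re) :
    0 ≤ (v * tailSeries N (fun j => ((N + j : ℕ) : ℂ) * (((N + j : ℕ) : ℂ) * b j)) z).re := by
  have hγ (t : ℝ) : HasDerivAt (fun t : ℝ => Complex.exp (t * I) * z)
      (I * (Complex.exp (t * I) * z)) t := by
    refine (((hasDerivAt_id (t : ℂ)).mul_const I).cexp.comp_ofReal.mul_const z).congr_deriv ?_
    simp only [id]; ring
  have hn (t : ℝ) : ‖Complex.exp (t * I) * z‖ = ‖z‖ := by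
    rw [norm_mul, Complex.norm_exp_ofReal_mul_I, one_mul]
  have hm (t : ℝ) : Complex.exp (t * I) * z ∈ unitDisk := by
    rw [mem_ball_zero_iff] at hz ⊢; rw [hn]; exact hz
  have h1 (t : ℝ) := hasDerivAt_re_const_mul
    (hasDerivAt_tailSeries_comp hN hb (hγ t) (hm t)) v
  have h2 := hasDerivAt_re_const_mul
    ((hasDerivAt_tailSeries_comp hN (hb.nat_add_mul N) (hγ 0) (hm 0)).const_mul I) v
  have h3 := second_deriv_nonpos_of_forall_le h1 h2 fun s => by
    simpa using hmax _ (hn s).le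
  rw [← mul_assoc I, I_mul_I] at h3
  simpa using h3

theorem tailSeries_add {N : ℕ} {b c : ℕ → ℂ} (hb : DiskSummable b) (hc : DiskSummable c) {z : ℂ}
    (hz : z ∈ unitDisk) :
    tailSeries N (fun j => b j + c j) z = tailSeries N b z + tailSeries N c z := by
  unfold tailSeries
  rw [← (hb.summable N hz).tsum_add (hc.summable N hz)]
  simp only [add_mul]

/-- A maximum principle for the operator `1 + a θ + c θ²`, where `θ = z d/dz`. -/
theorem re_le_re_of_forall_le {N : ℕ} (hN : 1 ≤ N) {b : ℕ → ℂ} (hb : DiskSummable b)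
    {a c : ℝ} (ha : 0 ≤ a) (hc : 0 ≤ c) {v z : ℂ} (hz : z ∈ unitDisk)
    (hmax : ∀ y : ℂ, ‖y‖ ≤ ‖z‖ → (v * tailSeries N b y).re ≤ (v * tailSeries N b z).re) :
    (v * tailSeries N b z).re ≤ (v * tailSeries N
      (fun j => (1 + a * ((N + j : ℕ) : ℂ) + c * ((N + j : ℕ) : ℂ) ^ 2) * b j) z).re := by
  have hb1 := hb.nat_add_mul N
  have hb2 := hb1.nat_add_mul N
  have h : tailSeries N
      (fun j => (1 + a * ((N + j : ℕ) : ℂ) + c * ((N + j : ℕ) : ℂ) ^ 2) * b j) z =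
      tailSeries N b z + (a * tailSeries N (fun j => ((N + j : ℕ) : ℂ) * b j) z +
        c * tailSeries N (fun j => ((N + j : ℕ) : ℂ) * (((N + j : ℕ) : ℂ) * b j)) z) := by
    rw [← tailSeries_const_mul, ← tailSeries_const_mul,
      ← tailSeries_add (hb1.const_mul _) (hb2.const_mul _) hz,
      ← tailSeries_add hb ((hb1.const_mul _).add (hb2.const_mul _)) hz]
    congr 1; ext j; ring
  have h1 := mul_nonneg ha (euler_re_nonneg hN hb hz hmax)
  have h2 := mul_nonneg hc (euler_sq_re_nonneg hN hb hz hmax)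
  rw [← re_ofReal_mul] at h1 h2
  rw [h, mul_add, mul_add, add_re, add_re, mul_left_comm v, mul_left_comm v]
  linarith

/-! ### Subordination as a convex gauge bound -/

/-- The convex function whose sublevel sets are the images of disks under
`z ↦ (1 + A z) / (1 + B z)`. -/
noncomputable def diskGauge (A B : ℝ) (w : ℂ) : ℝ :=
  (1 - B ^ 2) * (w.re ^ 2 + w.im ^ 2) - 2 * (1 - A * B) * w.re

/-- The inverse Möbius map is w ↦ (w - 1)/(A - Bw); the gauge inequality is the squared form of its
modulus being below 1. -/
theorem diskGauge_lt_iff {A B : ℝ} (w : ℂ) :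
    diskGauge A B w < A ^ 2 - 1 ↔ ‖w - 1‖ < ‖(A : ℂ) - B * w‖ := by
  rw [← sq_lt_sq₀ (norm_nonneg _) (norm_nonneg _), ← Complex.normSq_eq_norm_sq,
    ← Complex.normSq_eq_norm_sq, normSq_apply, normSq_apply]
  simp only [sub_re, sub_im, one_re, one_im, ofReal_re, ofReal_im, re_ofReal_mul, im_ofReal_mul,
    diskGauge]
  constructor <;> intro h <;> nlinarith

/-- The two sides differ by (1 - B²)|w - w₀|². -/
theorem diskGauge_supporting {A B : ℝ} (hB : B ^ 2 ≤ 1) (w₀ w : ℂ) :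
    diskGauge A B w₀ +
      2 * ((((1 - B ^ 2 : ℝ) : ℂ) * (starRingEnd ℂ) w₀ - ((1 - A * B : ℝ) : ℂ)) * (w - w₀)).re
      ≤ diskGauge A B w := by
  have h : 0 ≤ (1 - B ^ 2) * ((w.re - w₀.re) ^ 2 + (w.im - w₀.im) ^ 2) :=
    mul_nonneg (by linarith) (by positivity)
  simp only [diskGauge, mul_re, sub_re, sub_im, im_ofReal_mul, ofReal_re,
    ofReal_im, conj_re, conj_im]
  nlinarith

theorem diskGauge_lt_of_operator {N : ℕ} (hN : 1 ≤ N) {b : ℕ → ℂ} (hb : DiskSummable b)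
    {a c : ℝ} (ha : 0 ≤ a) (hc : 0 ≤ c) {A B K : ℝ} (hB : B ^ 2 ≤ 1)
    (hF : ∀ z ∈ unitDisk, diskGauge A B (1 + tailSeries N
      (fun j => (1 + a * ((N + j : ℕ) : ℂ) + c * ((N + j : ℕ) : ℂ) ^ 2) * b j) z) < K)
    {z : ℂ} (hz : z ∈ unitDisk) : diskGauge A B (1 + tailSeries N b z) < K := by
  have hsub : closedBall (0 : ℂ) ‖z‖ ⊆ unitDisk :=
    closedBall_subset_ball (by simpa using hz)
  have hcont : ContinuousOn (fun y => diskGauge A B (1 + tailSeries N b y))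
      (closedBall 0 ‖z‖) := by
    have h1 : ContinuousOn (fun y => 1 + tailSeries N b y) (closedBall 0 ‖z‖) :=
      continuousOn_const.add fun y hy =>
        (hasDerivAt_tailSeries hN hb (hsub hy)).continuousAt.continuousWithinAt
    have h2 : Continuous (diskGauge A B) := by unfold diskGauge; fun_prop
    exact h2.comp_continuousOn h1
  obtain ⟨z₀, hz₀, hmax⟩ := (isCompact_closedBall (0 : ℂ) ‖z‖).exists_isMaxOn
    ⟨z, by simp⟩ hcont
  -- Here v is half the gradient of the gauge at the maximum point, conjugated.
  have hle := re_le_re_of_forall_le hN hb ha hc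
    (v := ((1 - B ^ 2 : ℝ) : ℂ) * (starRingEnd ℂ) (1 + tailSeries N b z₀) -
      ((1 - A * B : ℝ) : ℂ)) (hsub hz₀) fun y hy => by
    have h1 := diskGauge_supporting (A := A) hB (1 + tailSeries N b z₀) (1 + tailSeries N b y)
    have h2 : diskGauge A B (1 + tailSeries N b y) ≤ diskGauge A B (1 + tailSeries N b z₀) :=
      hmax (mem_closedBall_zero_iff.2 (hy.trans (mem_closedBall_zero_iff.1 hz₀)))
    rw [add_sub_add_left_eq_sub, mul_sub, sub_re] at h1
    linarith
  have h1 := diskGauge_supporting (A := A) hB (1 + tailSeries N b z₀) (1 + tailSeries N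
      (fun j => (1 + a * ((N + j : ℕ) : ℂ) + c * ((N + j : ℕ) : ℂ) ^ 2) * b j) z₀)
  rw [add_sub_add_left_eq_sub, mul_sub, sub_re] at h1
  have h2 : diskGauge A B (1 + tailSeries N b z) ≤ diskGauge A B (1 + tailSeries N b z₀) :=
    hmax (mem_closedBall_zero_iff.2 le_rfl)
  have h3 := hF z₀ (hsub hz₀)
  linarith

theorem Subordinate.diskGauge_lt {A B : ℝ} (hAB : A < B) (hB0 : 0 < B) (hB1 : B ≤ 1) {F : ℂ → ℂ}
    (h : Subordinate F fun z => (1 + (A : ℂ) * z) / (1 + (B : ℂ) * z)) {z : ℂ}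
    (hz : z ∈ unitDisk) : diskGauge A B (F z) < A ^ 2 - 1 := by
  obtain ⟨w, -, -, hw, hF⟩ := h
  have hwz := hw z hz
  have hne : 1 + (B : ℂ) * w z ≠ 0 := fun h0 => by
    have h1 : ‖(B : ℂ) * w z‖ = 1 := by
      rw [eq_neg_of_add_eq_zero_right h0, norm_neg, norm_one]
    rw [norm_mul, norm_real, Real.norm_of_nonneg hB0.le] at h1
    nlinarith [norm_nonneg (w z)]
  have hAB' : (A : ℂ) - B ≠ 0 := by
    rw [← ofReal_sub]; exact_mod_cast (sub_neg.2 hAB).ne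
  rw [diskGauge_lt_iff, hF z hz]
  have e1 : (1 + (A : ℂ) * w z) / (1 + B * w z) - 1 = (A - B) / (1 + B * w z) * w z := by
    rw [div_sub_one hne]; ring
  have e2 : (A : ℂ) - B * ((1 + (A : ℂ) * w z) / (1 + B * w z)) = (A - B) / (1 + B * w z) := by
    rw [eq_div_iff hne, sub_mul, mul_assoc, div_mul_cancel₀ _ hne]; ring
  rw [e1, e2, norm_mul]
  exact mul_lt_of_lt_one_right (norm_pos_iff.2 (div_ne_zero hAB' hne)) hwz

theorem subordinate_of_diskGauge_lt {A B : ℝ} (hAB : A < B) {F : ℂ → ℂ}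
    (hd : DifferentiableOn ℂ F unitDisk) (h0 : F 0 = 1)
    (h : ∀ z ∈ unitDisk, diskGauge A B (F z) < A ^ 2 - 1) :
    Subordinate F fun z => (1 + (A : ℂ) * z) / (1 + (B : ℂ) * z) := by
  have hlt (z) (hz : z ∈ unitDisk) := (diskGauge_lt_iff (F z)).1 (h z hz)
  have hne (z) (hz : z ∈ unitDisk) : (A : ℂ) - B * F z ≠ 0 :=
    norm_pos_iff.1 ((norm_nonneg _).trans_lt (hlt z hz))
  have hAB' : (A : ℂ) - B ≠ 0 := by
    rw [← ofReal_sub]; exact_mod_cast (sub_neg.2 hAB).ne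
  refine ⟨fun z => (F z - 1) / (A - B * F z), ?_, by simp [h0], fun z hz => ?_, fun z hz => ?_⟩
  · exact (hd.sub_const 1).div ((hd.const_mul _).const_sub _) hne
  · rw [norm_div, div_lt_one (norm_pos_iff.2 (hne z hz))]
    exact hlt z hz
  · have hn := hne z hz
    have e1 : 1 + (A : ℂ) * ((F z - 1) / (A - B * F z)) = (A - B) * F z / (A - B * F z) := by
      rw [eq_div_iff hn, add_mul, mul_assoc, div_mul_cancel₀ _ hn]; ring
    have e2 : 1 + (B : ℂ) * ((F z - 1) / (A - B * F z)) = (A - B) / (A - B * F z) := by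
      rw [eq_div_iff hn, add_mul, mul_assoc, div_mul_cancel₀ _ hn]; ring
    simp only [e1, e2]
    rw [div_div_div_cancel_right₀ hn, mul_div_cancel_left₀ _ hAB']

/-! ### Taylor coefficients and multipliers -/

theorem diskSummable_taylorCoeff {f : ℂ → ℂ} (hf : DifferentiableOn ℂ f unitDisk) (N : ℕ) :
    DiskSummable fun j => taylorCoeff f (N + j) := by
  intro r h0 h1
  rcases h0.eq_or_lt with rfl | hr
  · refine summable_of_ne_finset_zero (s := {0}) fun j hj => ?_
    rw [zero_pow (by simpa using hj), mul_zero]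
  have hz : (r : ℂ) ∈ ball (0 : ℂ) ((1 : NNReal) : ℝ) := by
    simpa [abs_of_pos hr] using h1
  have hs := (Complex.hasSum_taylorSeries_on_ball (by simpa using hf) hz).summable.norm
  have hs' := ((summable_nat_add_iff N).2 hs).mul_left ((r ^ N)⁻¹)
  refine hs'.congr fun j => ?_
  simp only [taylorCoeff, sub_zero, smul_eq_mul, norm_mul, norm_inv, norm_pow, norm_div, norm_real,
    Real.norm_of_nonneg hr.le, pow_add, add_comm j N]
  field_simp

/-- The multiplier with exponent one, as a polynomial in `m = k - p`. -/
theorem multiplier_base {p l : ℝ} (hpl : 0 < p + l) (lam mu m : ℝ) :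
    ((p + m - p) * (lam * mu * (p + m) + lam - mu) + p + l) / (p + l) =
      1 + (lam * mu * p + lam - mu) / (p + l) * m + lam * mu / (p + l) * m ^ 2 := by
  field_simp; ring

theorem one_le_multiplier_base {p l : ℝ} (hp : 0 ≤ p) (hpl : 0 < p + l) {lam mu m : ℝ}
    (hmu : 0 ≤ mu) (hlam : mu ≤ lam) (hm : 0 ≤ m) :
    1 ≤ 1 + (lam * mu * p + lam - mu) / (p + l) * m + lam * mu / (p + l) * m ^ 2 := by
  have h0 : 0 ≤ lam * mu := mul_nonneg (hmu.trans hlam) hmu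
  have h1 : 0 ≤ (lam * mu * p + lam - mu) / (p + l) :=
    div_nonneg (by nlinarith [mul_nonneg h0 hp]) hpl.le
  have h2 : 0 ≤ lam * mu / (p + l) := div_nonneg h0 hpl.le
  have := mul_nonneg h1 hm
  have := mul_nonneg h2 (sq_nonneg m)
  linarith

theorem DiskSummable.quadratic_mul {b : ℕ → ℂ} (hb : DiskSummable b) (N : ℕ) (a c : ℝ) :
    DiskSummable fun j =>
      (((1 + a * ((N + j : ℕ) : ℝ) + c * ((N + j : ℕ) : ℝ) ^ 2 : ℝ)) : ℂ) * b j := by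
  convert hb.add (((hb.nat_add_mul N).const_mul a).add
    (((hb.nat_add_mul N).nat_add_mul N).const_mul c)) using 2
  push_cast; ring

/-- Since the base is at least 1, the real power is dominated by the natural power ⌈δ⌉₊, which is
handled by induction. -/
theorem DiskSummable.quadratic_rpow_mul {b : ℕ → ℂ} (hb : DiskSummable b) (N : ℕ) {a c δ : ℝ}
    (h1 : ∀ j : ℕ, 1 ≤ 1 + a * ((N + j : ℕ) : ℝ) + c * ((N + j : ℕ) : ℝ) ^ 2) :
    DiskSummable fun j =>
      (((1 + a * ((N + j : ℕ) : ℝ) + c * ((N + j : ℕ) : ℝ) ^ 2) ^ δ : ℝ) : ℂ) * b j := by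
  have hpow (D : ℕ) : DiskSummable fun j =>
      (((1 + a * ((N + j : ℕ) : ℝ) + c * ((N + j : ℕ) : ℝ) ^ 2) ^ D : ℝ) : ℂ) * b j := by
    induction D with
    | zero => simpa using hb
    | succ D ih =>
      convert ih.quadratic_mul N a c using 2
      push_cast; ring
  refine (hpow ⌈δ⌉₊).mono fun j => ?_
  have h0 := zero_le_one.trans (h1 j)
  rw [norm_mul, norm_mul, norm_real, norm_real, Real.norm_of_nonneg (Real.rpow_nonneg h0 _),
    Real.norm_of_nonneg (pow_nonneg h0 _)]
  refine mul_le_mul_of_nonneg_right ?_ (norm_nonneg _)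
  rw [← Real.rpow_natCast _ ⌈δ⌉₊]
  exact Real.rpow_le_rpow_of_exponent_le (h1 j) (Nat.le_ceil δ)

theorem normalizedDeriv_eq {n p : ℕ} (hn : 1 ≤ n) (hp : 1 ≤ p) {σ : ℝ} (hσ : σ < p) {b : ℕ → ℂ}
    (hb : DiskSummable b) {z : ℂ} (hz : z ∈ unitDisk) :
    normalizedDeriv p σ (fun z => z ^ p + tailSeries (n + p) b z) z =
      1 + tailSeries n (fun j => 1 / ((p : ℂ) - σ) * (((n + p + j : ℕ) : ℂ) * b j)) z := by
  unfold normalizedDeriv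
  split_ifs with h0
  · rw [h0, tailSeries_zero hn, add_zero]
  · have hd : HasDerivAt (fun z => z ^ p + tailSeries (n + p) b z) _ z :=
      (hasDerivAt_pow p z).add (hasDerivAt_tailSeries (by omega) hb hz)
    have hσ' : (p : ℂ) - σ ≠ 0 := by
      rw [← ofReal_natCast, ← ofReal_sub]; exact_mod_cast (sub_pos.2 hσ).ne'
    have hzp : z ^ (p - 1) ≠ 0 := pow_ne_zero _ h0
    rw [hd.deriv, tailSeries_const_mul, show n + p - 1 = n + (p - 1) by omega,
      tailSeries_add_index n (p - 1)]
    field_simp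
    ring

end Multivalent

theorem theorem2p1 (n p : ℕ) (hn : 1 ≤ n) (hp : 1 ≤ p)
    (lam mu l δ A B σ : ℝ)
    (hmu : 0 ≤ mu) (hlam : mu ≤ lam) (hl : 0 ≤ l) (hδ : 0 ≤ δ)
    (hA : -1 ≤ A) (hAB : A < B) (hB0 : 0 < B) (hB1 : B ≤ 1)
    (hσ0 : 0 ≤ σ) (hσp : σ < (p : ℝ))
    (h : lam - mu ≥ (l + (p : ℝ)) / (2 * (p : ℝ)) ∨ (lam = 0 ∧ mu = 0)) :
    Multivalent.classP n p lam mu l (δ + 1) A B σ ⊆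
      Multivalent.classP n p lam mu l δ A B σ := by
  open Multivalent in
  rintro f ⟨hf, hsub⟩
  refine ⟨hf, ?_⟩
  have hp0 : (0 : ℝ) < p := by exact_mod_cast hp
  have hpl : 0 < (p : ℝ) + l := by linarith
  have hlm : 0 ≤ lam * mu := mul_nonneg (hmu.trans hlam) hmu
  set a : ℝ := (lam * mu * p + lam - mu) / (p + l) with ha
  set c : ℝ := lam * mu / (p + l) with hc
  have ha0 : 0 ≤ a := div_nonneg (by nlinarith [mul_nonneg hlm hp0.le]) hpl.le
  have hc0 : 0 ≤ c := div_nonneg hlm hpl.le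
  have h1 (j : ℕ) : 1 ≤ 1 + a * ((n + j : ℕ) : ℝ) + c * ((n + j : ℕ) : ℝ) ^ 2 :=
    one_le_multiplier_base hp0.le hpl hmu hlam (Nat.cast_nonneg _)
  have hmult (ε : ℝ) (j : ℕ) : multiplier p (n + p + j) ε lam mu l =
      (1 + a * ((n + j : ℕ) : ℝ) + c * ((n + j : ℕ) : ℝ) ^ 2) ^ ε := by
    rw [ha, hc, ← multiplier_base hpl, multiplier]
    push_cast
    congr 3; ring
  let b (ε : ℝ) (j : ℕ) : ℂ :=
    (multiplier p (n + p + j) ε lam mu l : ℂ) * taylorCoeff f (n + p + j)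
  have hb (ε : ℝ) : DiskSummable (b ε) := by
    simp only [b, hmult]
    exact (diskSummable_taylorCoeff hf.1 (n + p)).quadratic_rpow_mul n h1
  let e (ε : ℝ) (j : ℕ) : ℂ := 1 / ((p : ℂ) - σ) * (((n + p + j : ℕ) : ℂ) * b ε j)
  have he : DiskSummable (e δ) := ((hb δ).nat_add_mul (n + p)).const_mul _
  have hN (ε : ℝ) {z : ℂ} (hz : z ∈ unitDisk) :
      normalizedDeriv p σ (multiplierTransform n p ε lam mu l f) z = 1 + tailSeries n (e ε) z :=
    normalizedDeriv_eq hn hp hσp (hb ε) hz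
  -- Raising the exponent by one multiplies each coefficient by the base, i.e. applies 1 + aθ + cθ².
  have hstep : e (δ + 1) =
      fun j => (1 + a * ((n + j : ℕ) : ℂ) + c * ((n + j : ℕ) : ℂ) ^ 2) * e δ j := by
    ext j
    simp only [e, b, hmult, Real.rpow_add_one (zero_lt_one.trans_le (h1 j)).ne']
    push_cast
    ring
  refine subordinate_of_diskGauge_lt hAB ?_ (by simp [normalizedDeriv]) fun z hz => ?_
  · refine DifferentiableOn.congr (f := fun z => 1 + tailSeries n (e δ) z) ?_ fun z hz => hN δ hz
    exact fun z hz => ((hasDerivAt_tailSeries hn he hz).const_add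
      1).differentiableAt.differentiableWithinAt
  · rw [hN δ hz]
    refine diskGauge_lt_of_operator hn he ha0 hc0 (by nlinarith) (fun y hy => ?_) hz
    rw [← hstep, ← hN (δ + 1) hy]
    exact hsub.diskGauge_lt hAB hB0 hB1 hy
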